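/- For $n \ge 0$ and $T \subseteq \mathbb{F}_2^n$ let $$\mathcal{S}(T) = \{(x,y,z) \in T^3 : x + y = z,\ x \neq y,\ x \neq 0,\ y \neq 0\}$$ be the set of Schur triples in $T$, and let $s(T) = |\mathcal{S}(T)| / |\mathcal{S}(\mathbb{F}_2^n)|$ (for $n \geq 2$; finitely many $n$ do not matter below). Then the Rado multiplicity of Schur triples in $3$-colorings of $\mathbb{F}_2^n$, $$m_{2,3}(\mathrm{Schur}) = \lim_{n \to \infty}\ \min_{\gamma : \mathbb{F}_2^n \to \{1,2,3\}} \Big( s(\gamma^{-1}(1)) + s(\gamma^{-1}(2)) + s(\gamma^{-1}(3)) \Big),$$ exists and satisfies $$0.041258 \;\leq\; m_{2,3}(\mathrm{Schur}) \;\leq\; \frac{1}{16} \;<\; \frac{1}{9} = 3^{1-3}.$$ In particular $m_{2,3}(\mathrm{Schur}) \neq 3^{1-3}$, that is, Schur triples are not $3$-common for $q = 2$. -/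

import Mathlib

open Filter Topology

/-- The set `S_L(T)` of solutions `s ∈ T^m` of `A · s = 0` with pairwise distinct entries, where
`L` is the linear map given by the integer matrix `A` with `r` rows and `m` columns and `T` is a
subset of `F^n`. -/
def solutionSet {F : Type} [Field F] {r m : ℕ} (A : Matrix (Fin r) (Fin m) ℤ) {n : ℕ}
    (T : Set (Fin n → F)) : Set (Fin m → (Fin n → F)) :=
  {s | (∀ j, s j ∈ T) ∧ (∀ i, ∑ j, A i j • s j = 0) ∧ ∀ i j, i ≠ j → s i ≠ s j}

/-- The normalised number of solutions `s_L(T) = |S_L(T)| / |S_L(F^n)|`. -/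
noncomputable def solutionDensity {F : Type} [Field F] {r m : ℕ}
    (A : Matrix (Fin r) (Fin m) ℤ) {n : ℕ} (T : Set (Fin n → F)) : ℝ :=
  ((solutionSet A T).ncard : ℝ) / ((solutionSet A (Set.univ : Set (Fin n → F))).ncard : ℝ)

/-- `s_L(γ⁽¹⁾) + … + s_L(γ⁽ᶜ⁾)`, the proportion of solutions that are monochromatic under the
`c`-coloring `γ` of `F^n`. -/
noncomputable def monochromaticDensity {F : Type} [Field F] {r m : ℕ}
    (A : Matrix (Fin r) (Fin m) ℤ) {n c : ℕ} (γ : (Fin n → F) → Fin c) : ℝ :=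
  ∑ i, solutionDensity A (γ ⁻¹' {i})

/-- The minimum of the monochromatic density over all `c`-colorings of `F^n`
(for finite `F` and `c ≥ 1` the infimum is over a finite nonempty family). -/
noncomputable def minMonochromaticDensity (F : Type) [Field F] (c : ℕ) {r m : ℕ}
    (A : Matrix (Fin r) (Fin m) ℤ) (n : ℕ) : ℝ :=
  ⨅ γ : (Fin n → F) → Fin c, monochromaticDensity A γ

/-- The Rado multiplicity `m_{q,c}(L)`, the limit of the minimum monochromatic density as the
dimension tends to infinity (`F` is the field with `q` elements). -/
noncomputable def radoMultiplicity (F : Type) [Field F] (c : ℕ) {r m : ℕ}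
    (A : Matrix (Fin r) (Fin m) ℤ) : ℝ :=
  limUnder atTop (minMonochromaticDensity F c A)

/-- `L` is `c`-common over `F` if `m_{q,c}(L) = c^(1-m)`. -/
def IsCommon (F : Type) [Field F] (c : ℕ) {r m : ℕ} (A : Matrix (Fin r) (Fin m) ℤ) : Prop :=
  radoMultiplicity F c A = (c : ℝ) ^ (1 - (m : ℤ))

/-- The matrix of the equation `x + y = z`. -/
def schurMatrix : Matrix (Fin 1) (Fin 3) ℤ := !![1, 1, -1]

/-- The solutions of `schurMatrix` with distinct entries are exactly the Schur triples
`(x, y, z)` with `x + y = z`, `x ≠ y`, `x ≠ 0`, `y ≠ 0`. -/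
theorem mem_solutionSet_schurMatrix {F : Type} [Field F] {n : ℕ} (T : Set (Fin n → F))
    (s : Fin 3 → (Fin n → F)) :
    s ∈ solutionSet schurMatrix T ↔
      (s 0 ∈ T ∧ s 1 ∈ T ∧ s 2 ∈ T) ∧ s 0 + s 1 = s 2 ∧ s 0 ≠ s 1 ∧ s 0 ≠ 0 ∧ s 1 ≠ 0 := by
  have h : (∀ i, ∑ j, schurMatrix i j • s j = 0) ↔ s 0 + s 1 = s 2 := by
    simp [schurMatrix, Fin.sum_univ_three, ← sub_eq_add_neg, sub_eq_zero]
  simp only [solutionSet, Set.mem_ofPred_eq]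
  rw [h]
  simp only [Fin.forall_fin_succ]
  constructor
  · rintro ⟨hT, he, hd⟩
    simp at hT hd
    refine ⟨⟨hT.1, hT.2.1, hT.2.2⟩, he, by tauto, ?_, ?_⟩
    · intro h0
      rw [h0, zero_add] at he
      tauto
    · intro h0
      rw [h0, add_zero] at he
      tauto
  · rintro ⟨hT, he, h01, h0, h1⟩
    have h02 : s 0 ≠ s 2 := by
      intro h
      rw [← he] at h
      exact h1 (by simpa using h)
    have h12 : s 1 ≠ s 2 := by
      intro h
      rw [← he] at h
      exact h0 (by simpa using h)
    refine ⟨by simpa using hT, he, ?_⟩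
    simp [h01, h02, h12, h01.symm, h02.symm, h12.symm]

/-! Once degenerate pairs are admitted, which costs `O(2⁻ⁿ)`, pulling a coloring back to a higher
dimension preserves its monochromatic ratio. The minimum ratio is thus antitone in `n`, so the limit
exists and any single coloring bounds it above. The lower bound is a flag-algebra style certificate:
every 3-coloring of the Fano plane satisfies 309 · (monochromatic lines) − 2 · (cross terms) ≥ 90
(`le_sum_localCertificate`). Averaged over all spanned configurations, the cross terms become
squares (`sum_crossWeight_nonneg`) and can be dropped, leaving the density at least 90 / (7 · 309).
-/

/-! ### A sum of squares certificate on colorings of `𝔽₂³` -/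

/-- The weight of a line through a point of color `i` whose other points have colors `j`, `k`;
it is invariant under the exchange of the two colors other than `i`. -/
def evenWeight (i j k : Fin 3) : ℤ :=
  if j = k then (if j = i then 7 else -3) else if j = i ∨ k = i then 0 else 3

/-- The weight of a line through a point of color `i` whose other points have colors `j`, `k`;
it changes sign under the exchange of the two colors other than `i`. -/
def oddWeight (i j k : Fin 3) : ℤ :=
  (![![0, 4, -4], ![4, 2, 0], ![-4, 0, -2]] : Fin 3 → Fin 3 → ℤ) (j - i) (k - i)

/-- The products of the weights of pairs of lines among the three lines `{i, p, p'}`, `{i, q, q'}`,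
`{i, r, r'}`. -/
def crossWeight (h : Fin 3 → Fin 3 → Fin 3 → ℤ) (i p p' q q' r r' : Fin 3) : ℤ :=
  h i p p' * h i q q' + h i p p' * h i r r' + h i q q' * h i r r'

/-- The indicator that three colors agree. -/
def monoIndicator (i j k : Fin 3) : ℤ := if i = j ∧ j = k then 1 else 0

/-- The contribution of one point of the Fano plane to the certificate: the first color is that of
the point, followed by the pairs of colors on the lines through it. -/
def localCertificate (i p p' q q' r r' : Fin 3) : ℤ :=
  309 * monoIndicator i p p' -
    2 * (crossWeight evenWeight i p p' q q' r r' + crossWeight oddWeight i p p' q q' r r')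

-- The lines are `{k, k+1, k+3}` mod 7. Each point charges only its first line to `monoIndicator`,
-- so every line counts once. All 3⁷ colorings are checked.
set_option maxRecDepth 100000 in
theorem le_sum_localCertificate : ∀ c0 c1 c2 c3 c4 c5 c6 : Fin 3,
    90 ≤ localCertificate c0 c1 c3 c2 c6 c4 c5 + localCertificate c1 c2 c4 c3 c0 c5 c6 +
      localCertificate c2 c3 c5 c4 c1 c6 c0 + localCertificate c3 c4 c6 c5 c2 c0 c1 +
      localCertificate c4 c5 c0 c6 c3 c1 c2 + localCertificate c5 c6 c1 c0 c4 c2 c3 +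
      localCertificate c6 c0 c2 c1 c5 c3 c4 := by
  decide +kernel

/-! ### Monochromatic pairs in groups of exponent two -/

section Group

variable {G : Type*} [AddCommGroup G]

/-- The linear substitution `(a, b, c) ↦ (b, c, a + b)`, which permutes the seven nonzero
combinations of `a`, `b`, `c` cyclically when `G` has exponent two. -/
def singerCycle : G × G × G ≃ G × G × G where
  toFun v := (v.2.1, v.2.2, v.1 + v.2.1)
  invFun v := (v.2.2 - v.1, v.1, v.2.1)
  left_inv v := by simp
  right_inv v := by simp

/-- `localCertificate` on the configuration spanned by three elements of `G`. -/
def configCertificate (γ : G → Fin 3) (v : G × G × G) : ℤ :=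
  localCertificate (γ v.1) (γ v.2.1) (γ (v.1 + v.2.1)) (γ v.2.2) (γ (v.1 + v.2.2))
    (γ (v.2.1 + v.2.2)) (γ (v.1 + (v.2.1 + v.2.2)))

theorem le_sum_configCertificate (hG : ∀ x : G, x + x = 0) (γ : G → Fin 3) (v : G × G × G) :
    90 ≤ ∑ k ∈ Finset.range 7, configCertificate γ ((singerCycle ^ k : Equiv.Perm _) v) := by
  obtain ⟨a, b, c⟩ := v
  have hG' : ∀ x y : G, x + (x + y) = y := fun x y => by rw [← add_assoc, hG, zero_add]
  -- This is the orbit of `a` under the cycle. Dependent `a`, `b`, `c` are harmless, as the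
  -- inequality holds for arbitrary colors.
  have := le_sum_localCertificate (γ a) (γ b) (γ c) (γ (a + b)) (γ (b + c)) (γ (a + (b + c)))
    (γ (a + c))
  refine this.trans (le_of_eq ?_)
  simp only [Finset.sum_range_succ, Finset.sum_range_zero, pow_succ, pow_zero, one_mul,
    Equiv.Perm.mul_apply, Equiv.Perm.one_apply, singerCycle, Equiv.coe_fn_mk, configCertificate,
    add_comm, add_left_comm, hG, hG', add_zero]

variable [Fintype G]

/-- The number of pairs `(x, y)`, degenerate ones included, such that `x`, `y`, `x + y` have the
same color. -/
def monoCount (γ : G → Fin 3) : ℤ := ∑ x, ∑ y, monoIndicator (γ x) (γ y) (γ (x + y))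

theorem sum_sum_add (F : G → G → ℤ) : ∑ b, ∑ c, F b (b + c) = ∑ b, ∑ c, F b c :=
  Finset.sum_congr rfl fun b _ => Equiv.sum_comp (Equiv.addLeft b) (F b)

/-- The lines through `a` are indexed by `b`, `c`, `b + c`. Any two of these range uniformly over `G
× G`, so each product sums to the same square. -/
theorem sum_crossWeight_nonneg (h : Fin 3 → Fin 3 → Fin 3 → ℤ) (γ : G → Fin 3) :
    0 ≤ ∑ a, ∑ b, ∑ c, crossWeight h (γ a) (γ b) (γ (a + b)) (γ c) (γ (a + c)) (γ (b + c))
      (γ (a + (b + c))) := by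
  refine Finset.sum_nonneg fun a _ => ?_
  set H : G → ℤ := fun x => h (γ a) (γ x) (γ (a + x)) with hH
  have h1 : ∑ b, ∑ c, H b * H c = (∑ b, H b) ^ 2 := by
    rw [sq, Finset.sum_mul_sum]
  have h2 : ∑ b, ∑ c, H b * H (b + c) = (∑ b, H b) ^ 2 := by
    rw [← h1]
    exact sum_sum_add fun x y => H x * H y
  have h3 : ∑ b, ∑ c, H c * H (b + c) = (∑ b, H b) ^ 2 := by
    rw [Finset.sum_comm, ← h2]
    simp only [add_comm]
  have : ∑ b, ∑ c, crossWeight h (γ a) (γ b) (γ (a + b)) (γ c) (γ (a + c)) (γ (b + c))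
      (γ (a + (b + c))) = 3 * (∑ b, H b) ^ 2 := by
    simp only [crossWeight, Finset.sum_add_distrib]
    rw [h1, h2, h3]
    ring
  rw [this]
  positivity

theorem le_monoCount (hG : ∀ x : G, x + x = 0) (γ : G → Fin 3) :
    90 * (Fintype.card G : ℤ) ^ 2 ≤ 2163 * monoCount γ := by
  have hsum : 90 * (Fintype.card G : ℤ) ^ 3 ≤ 7 * ∑ v, configCertificate γ v := by
    calc 90 * (Fintype.card G : ℤ) ^ 3 = ∑ _v : G × G × G, 90 := by
          simp; ring
      _ ≤ ∑ v, ∑ k ∈ Finset.range 7, configCertificate γ ((singerCycle ^ k : Equiv.Perm _) v) :=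
          Finset.sum_le_sum fun v _ => le_sum_configCertificate hG γ v
      _ = ∑ k ∈ Finset.range 7, ∑ v, configCertificate γ v := by
          rw [Finset.sum_comm]
          exact Finset.sum_congr rfl fun k _ => Equiv.sum_comp _ _
      _ = 7 * ∑ v, configCertificate γ v := by simp
  have hcert : ∑ v, configCertificate γ v ≤ 309 * (Fintype.card G * monoCount γ) := by
    have h1 := sum_crossWeight_nonneg evenWeight γ
    have h2 := sum_crossWeight_nonneg oddWeight γ
    have h3 : ∑ a, ∑ b, ∑ _c : G, monoIndicator (γ a) (γ b) (γ (a + b)) =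
        Fintype.card G * monoCount γ := by
      simp [monoCount, Finset.mul_sum]
    simp only [Fintype.sum_prod_type, configCertificate, localCertificate, Finset.sum_sub_distrib,
      ← Finset.mul_sum, Finset.sum_add_distrib, h3]
    linarith
  have hpos : (0 : ℤ) < Fintype.card G := by exact_mod_cast Fintype.card_pos
  -- One factor `|G|` cancels; 2163 = 7 · 309.
  nlinarith

end Group

/-! ### Comparison with the density of Schur triples -/

/-- The indicator of the pairs `(x, y)` that give a Schur triple with distinct entries. -/
noncomputable def nondegIndicator {G : Type*} [AddCommGroup G] (x y : G) : ℤ :=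
  open Classical in if x ≠ y ∧ x ≠ 0 ∧ y ≠ 0 then 1 else 0

theorem ncard_solutionSet_schurMatrix {F : Type} [Field F] [Fintype F] {n : ℕ}
    (T : Set (Fin n → F)) :
    ((solutionSet schurMatrix T).ncard : ℤ) = ∑ x, ∑ y, nondegIndicator x y *
      (open Classical in if x ∈ T ∧ y ∈ T ∧ x + y ∈ T then 1 else 0) := by
  classical
  have himage : solutionSet schurMatrix T = (fun p : (Fin n → F) × (Fin n → F) =>
      (![p.1, p.2, p.1 + p.2] : Fin 3 → Fin n → F)) ''
        {p | (p.1 ≠ p.2 ∧ p.1 ≠ 0 ∧ p.2 ≠ 0) ∧ p.1 ∈ T ∧ p.2 ∈ T ∧ p.1 + p.2 ∈ T} := by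
    ext s
    rw [mem_solutionSet_schurMatrix]
    constructor
    · rintro ⟨⟨h0, h1, h2⟩, he, hd⟩
      refine ⟨(s 0, s 1), ⟨hd, h0, h1, by simpa only [he] using h2⟩, ?_⟩
      funext i
      fin_cases i <;> simp [he]
    · rintro ⟨p, ⟨hd, h0, h1, h2⟩, rfl⟩
      exact ⟨⟨h0, h1, h2⟩, rfl, hd⟩
  have hinj : Function.Injective (fun p : (Fin n → F) × (Fin n → F) =>
      (![p.1, p.2, p.1 + p.2] : Fin 3 → Fin n → F)) := fun p q h =>
    Prod.ext (congrFun h 0) (congrFun h 1)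
  rw [himage, Set.ncard_image_of_injective _ hinj, Set.ncard_eq_toFinset_card',
    Set.toFinset_ofPred, Finset.card_filter, Fintype.sum_prod_type]
  push_cast
  refine Finset.sum_congr rfl fun x _ => Finset.sum_congr rfl fun y _ => ?_
  simp only [nondegIndicator, ite_and, mul_ite, mul_one, mul_zero]
  split_ifs <;> rfl

theorem sum_nondegIndicator_le {G : Type*} [AddCommGroup G] [Fintype G] :
    ∑ x : G, ∑ y : G, (1 - nondegIndicator x y) ≤ 3 * Fintype.card G := by
  classical
  calc ∑ x : G, ∑ y : G, (1 - nondegIndicator x y)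
      ≤ ∑ x : G, ∑ y : G, ((if x = y then 1 else 0) + (if x = 0 then 1 else 0) +
          (if y = 0 then 1 else 0) : ℤ) := by
        refine Finset.sum_le_sum fun x _ => Finset.sum_le_sum fun y _ => ?_
        unfold nondegIndicator
        split_ifs <;> simp_all
    _ = 3 * Fintype.card G := by
        simp [Finset.sum_add_distrib]
        ring

/-- The proportion of pairs `(x, y)`, degenerate ones included, such that `x`, `y`, `x + y` have
the same color. -/
noncomputable def monoRatio {G : Type*} [AddCommGroup G] [Fintype G] (γ : G → Fin 3) : ℝ :=
  monoCount γ / (Fintype.card G : ℝ) ^ 2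

theorem abs_monochromaticDensity_sub_monoRatio_le {F : Type} [Field F] [Fintype F] {n : ℕ}
    (γ : (Fin n → F) → Fin 3) :
    |monochromaticDensity schurMatrix γ - monoRatio γ| ≤ 3 / Fintype.card (Fin n → F) := by
  classical
  set S : ℤ := ∑ x, ∑ y, nondegIndicator x y * monoIndicator (γ x) (γ y) (γ (x + y)) with hS
  set D : ℤ := ∑ x : Fin n → F, ∑ y : Fin n → F, nondegIndicator x y with hD
  set N : ℕ := Fintype.card (Fin n → F) with hN
  have hnd : ∀ x y : Fin n → F, 0 ≤ nondegIndicator x y ∧ nondegIndicator x y ≤ 1 := by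
    intro x y
    unfold nondegIndicator
    split_ifs <;> simp
  have hmi : ∀ i j k : Fin 3, 0 ≤ monoIndicator i j k ∧ monoIndicator i j k ≤ 1 := by decide
  have hdens : monochromaticDensity schurMatrix γ = (S : ℝ) / D := by
    have hi : ∀ i, ((solutionSet schurMatrix (γ ⁻¹' {i})).ncard : ℝ) =
        ((∑ x, ∑ y, nondegIndicator x y *
          if γ x = i ∧ γ y = i ∧ γ (x + y) = i then 1 else 0 : ℤ) : ℝ) := by
      intro i
      rw [← Int.cast_natCast, ncard_solutionSet_schurMatrix]
      congr! 6
    have huniv : ((solutionSet schurMatrix (Set.univ : Set (Fin n → F))).ncard : ℝ) = D := by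
      rw [← Int.cast_natCast, ncard_solutionSet_schurMatrix]
      simp [hD]
    unfold monochromaticDensity solutionDensity
    rw [← Finset.sum_div, huniv]
    congr 1
    rw [Finset.sum_congr rfl fun i _ => hi i, ← Int.cast_sum, Finset.sum_comm, hS]
    congr 1
    refine Finset.sum_congr rfl fun x _ => ?_
    rw [Finset.sum_comm]
    refine Finset.sum_congr rfl fun y _ => ?_
    rw [← Finset.mul_sum]
    congr 1
    generalize γ x = i, γ y = j, γ (x + y) = k
    revert i j k
    decide
  have hS0 : 0 ≤ S := Finset.sum_nonneg fun x _ => Finset.sum_nonneg fun y _ =>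
    mul_nonneg (hnd x y).1 (hmi _ _ _).1
  have hSD : S ≤ D := Finset.sum_le_sum fun x _ => Finset.sum_le_sum fun y _ =>
    mul_le_of_le_one_right (hnd x y).1 (hmi _ _ _).2
  have hST : S ≤ monoCount γ := Finset.sum_le_sum fun x _ => Finset.sum_le_sum fun y _ =>
    mul_le_of_le_one_left (hmi _ _ _).1 (hnd x y).2
  have hdeg : (N : ℤ) ^ 2 - D ≤ 3 * N := by
    refine le_trans (le_of_eq ?_) (sum_nondegIndicator_le (G := Fin n → F))
    simp only [Finset.sum_sub_distrib, hD, hN]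
    simp [sq]
  have hTS : monoCount γ - S ≤ 3 * N := by
    refine le_trans ?_ (sum_nondegIndicator_le (G := Fin n → F))
    rw [monoCount, hS]
    simp only [← Finset.sum_sub_distrib]
    refine Finset.sum_le_sum fun x _ => Finset.sum_le_sum fun y _ => ?_
    rw [← one_sub_mul]
    exact mul_le_of_le_one_right (sub_nonneg.2 (hnd x y).2) (hmi _ _ _).2
  have hDN : D ≤ (N : ℤ) ^ 2 := by
    calc D ≤ ∑ x : Fin n → F, ∑ y : Fin n → F, 1 :=
          Finset.sum_le_sum fun x _ => Finset.sum_le_sum fun y _ => (hnd x y).2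
      _ = (N : ℤ) ^ 2 := by simp [sq, hN]
  have hNpos : (0 : ℝ) < N := by exact_mod_cast (Fintype.card_pos : 0 < Fintype.card (Fin n → F))
  have hS0' : (0 : ℝ) ≤ S := by exact_mod_cast hS0
  have hSD' : (S : ℝ) ≤ D := by exact_mod_cast hSD
  have hST' : (S : ℝ) ≤ monoCount γ := by exact_mod_cast hST
  have hdeg' : (N : ℝ) ^ 2 - D ≤ 3 * N := by exact_mod_cast hdeg
  have hTS' : (monoCount γ : ℝ) - S ≤ 3 * N := by exact_mod_cast hTS
  have hDN' : (D : ℝ) ≤ (N : ℝ) ^ 2 := by exact_mod_cast hDN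
  set q : ℝ := S / D with hq
  have hq0 : 0 ≤ q := div_nonneg hS0' (hS0'.trans hSD')
  have hq1 : q ≤ 1 := div_le_one_of_le₀ hSD' (hS0'.trans hSD')
  -- If `D = 0` then `S = 0` as well, so the convention `S / 0 = 0` does no harm.
  have hqD : q * D = S := by
    rcases (hS0'.trans hSD').eq_or_lt with h0 | h0
    · rw [← h0, mul_zero]
      linarith
    · exact div_mul_cancel₀ _ h0.ne'
  rw [hdens, monoRatio, ← hN, abs_le]
  -- The numerator is `q (N² - D) - (monoCount γ - S)`, a difference of two quantities in `[0, 3N]`.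
  have key : q - monoCount γ / (N : ℝ) ^ 2 = (q * N ^ 2 - monoCount γ) / N ^ 2 := by
    field_simp
  have h3 : 3 / (N : ℝ) = 3 * N / N ^ 2 := by
    field_simp
  rw [key, h3, ← neg_div]
  constructor
  · refine div_le_div_of_nonneg_right ?_ (by positivity)
    nlinarith
  · refine div_le_div_of_nonneg_right ?_ (by positivity)
    nlinarith

/-! ### The limit -/

/-- The minimum of `monoRatio` over the `3`-colorings of `𝔽₂ⁿ`. -/
noncomputable def minMonoRatio (n : ℕ) : ℝ :=
  ⨅ γ : (Fin n → ZMod 2) → Fin 3, monoRatio γ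

theorem bddBelow_range_monoRatio (n : ℕ) :
    BddBelow (Set.range fun γ : (Fin n → ZMod 2) → Fin 3 => monoRatio γ) :=
  (Set.finite_range _).bddBelow

theorem sum_comp_tail {M : Type*} [AddCommMonoid M] (n : ℕ) (f : (Fin n → ZMod 2) → M) :
    ∑ x : Fin (n + 1) → ZMod 2, f (Fin.tail x) = 2 • ∑ x, f x := by
  rw [← (Fin.consEquiv fun _ : Fin (n + 1) => ZMod 2).sum_comp, Fintype.sum_prod_type]
  simp [Fin.consEquiv]

theorem monoRatio_comp_tail (n : ℕ) (γ : (Fin n → ZMod 2) → Fin 3) :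
    monoRatio (fun x : Fin (n + 1) → ZMod 2 => γ (Fin.tail x)) = monoRatio γ := by
  have h : monoCount (fun x : Fin (n + 1) → ZMod 2 => γ (Fin.tail x)) = 4 * monoCount γ := by
    unfold monoCount
    have h1 : ∀ z : Fin n → ZMod 2, ∑ y : Fin (n + 1) → ZMod 2,
        monoIndicator (γ z) (γ (Fin.tail y)) (γ (z + Fin.tail y)) =
          2 • ∑ y, monoIndicator (γ z) (γ y) (γ (z + y)) := fun z =>
      sum_comp_tail n fun y => monoIndicator (γ z) (γ y) (γ (z + y))
    have h2 := sum_comp_tail n fun z => ∑ y : Fin (n + 1) → ZMod 2,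
        monoIndicator (γ z) (γ (Fin.tail y)) (γ (z + Fin.tail y))
    refine h2.trans ?_
    simp only [h1, ← Finset.smul_sum]
    ring
  unfold monoRatio
  rw [h]
  simp only [Fintype.card_fun, ZMod.card, Fintype.card_fin]
  push_cast
  field_simp
  ring

theorem antitone_minMonoRatio : Antitone minMonoRatio :=
  antitone_nat_of_succ_le fun n => le_ciInf fun γ =>
    (ciInf_le (bddBelow_range_monoRatio (n + 1)) _).trans_eq (monoRatio_comp_tail n γ)

theorem le_minMonoRatio (n : ℕ) : (90 / 2163 : ℝ) ≤ minMonoRatio n := by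
  refine le_ciInf fun γ => ?_
  have h := le_monoCount (fun x => funext fun i => CharTwo.add_self_eq_zero (x i)) γ
  have hpos : (0 : ℝ) < Fintype.card (Fin n → ZMod 2) := by exact_mod_cast Fintype.card_pos
  rw [monoRatio, le_div_iff₀ (by positivity), div_mul_eq_mul_div, div_le_iff₀' (by norm_num)]
  exact_mod_cast h

/-- The classes `x 0 = 1` and `x 0 = 0, x 1 = 1` are sum-free; the third is `{0}`, contributing only
the pair `(0, 0)` out of 16. -/
theorem minMonoRatio_two_le : minMonoRatio 2 ≤ 1 / 16 := by
  refine (ciInf_le (bddBelow_range_monoRatio 2)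
    fun x => if x 0 = 1 then 0 else if x 1 = 1 then 1 else 2).trans ?_
  have : monoCount (fun x : Fin 2 → ZMod 2 =>
      (if x 0 = 1 then 0 else if x 1 = 1 then 1 else 2 : Fin 3)) = 1 := by
    decide +kernel
  rw [monoRatio, this]
  norm_num [ZMod.card]

theorem abs_minMonochromaticDensity_sub_le (n : ℕ) :
    |minMonochromaticDensity (ZMod 2) 3 schurMatrix n - minMonoRatio n| ≤ 3 / 2 ^ n := by
  have h := fun γ : (Fin n → ZMod 2) → Fin 3 =>
    abs_le.1 (abs_monochromaticDensity_sub_monoRatio_le γ)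
  simp only [Fintype.card_fun, ZMod.card, Fintype.card_fin, Nat.cast_pow, Nat.cast_ofNat] at h
  obtain ⟨γ₁, h₁⟩ := exists_eq_ciInf_of_finite
    (f := fun γ : (Fin n → ZMod 2) → Fin 3 => monochromaticDensity schurMatrix γ)
  obtain ⟨γ₂, h₂⟩ := exists_eq_ciInf_of_finite
    (f := fun γ : (Fin n → ZMod 2) → Fin 3 => monoRatio γ)
  have h₃ : minMonoRatio n ≤ monoRatio γ₁ := ciInf_le (bddBelow_range_monoRatio n) γ₁
  have h₄ : minMonochromaticDensity (ZMod 2) 3 schurMatrix n ≤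
      monochromaticDensity schurMatrix γ₂ := ciInf_le (Set.finite_range _).bddBelow γ₂
  have h₅ : monochromaticDensity schurMatrix γ₁ =
      minMonochromaticDensity (ZMod 2) 3 schurMatrix n := h₁
  have h₆ : monoRatio γ₂ = minMonoRatio n := h₂
  rw [abs_le]
  constructor <;> linarith [h γ₁, h γ₂]

theorem exists_tendsto_minMonochromaticDensity :
    ∃ l : ℝ, Tendsto (minMonochromaticDensity (ZMod 2) 3 schurMatrix) atTop (𝓝 l) ∧
      90 / 2163 ≤ l ∧ l ≤ 1 / 16 := by
  have hbdd : BddBelow (Set.range minMonoRatio) :=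
    ⟨90 / 2163, Set.forall_mem_range.2 le_minMonoRatio⟩
  have hlim := tendsto_atTop_ciInf antitone_minMonoRatio hbdd
  refine ⟨⨅ n, minMonoRatio n, ?_, le_ciInf le_minMonoRatio,
    (ciInf_le hbdd 2).trans minMonoRatio_two_le⟩
  have herr : Tendsto (fun n : ℕ => (3 : ℝ) / 2 ^ n) atTop (𝓝 0) :=
    tendsto_const_nhds.div_atTop (tendsto_pow_atTop_atTop_of_one_lt (by norm_num))
  have hdiff := squeeze_zero_norm
    (f := fun n => minMonochromaticDensity (ZMod 2) 3 schurMatrix n - minMonoRatio n)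
    abs_minMonochromaticDensity_sub_le herr
  simpa using hdiff.add hlim

theorem mainTheorem3 :
    Tendsto (minMonochromaticDensity (ZMod 2) 3 schurMatrix) atTop
        (𝓝 (radoMultiplicity (ZMod 2) 3 schurMatrix)) ∧
      (0.041258 : ℝ) ≤ radoMultiplicity (ZMod 2) 3 schurMatrix ∧
      radoMultiplicity (ZMod 2) 3 schurMatrix ≤ 1 / 16 ∧
      (1 / 16 : ℝ) < 1 / 9 ∧
      ¬ IsCommon (ZMod 2) 3 schurMatrix := by
  obtain ⟨l, hl, hlow, hup⟩ := exists_tendsto_minMonochromaticDensity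
  have heq : radoMultiplicity (ZMod 2) 3 schurMatrix = l := hl.limUnder_eq
  rw [IsCommon, heq]
  refine ⟨hl, le_trans (by norm_num) hlow, hup, by norm_num, fun h => ?_⟩
  rw [h] at hup
  norm_num [zpow_neg] at hup
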